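/- A clutter $\mathcal C$ on a finite vertex set $V$ is a family of subsets of $V$ (circuits), none of which is contained in another one. A set $\sigma\subseteq V$ is independent if it contains no circuit, and $I(\mathcal C)$ is the simplicial complex of all independent sets. For $v\in V$, the contraction $\mathcal C/v$ is the clutter on $V\setminus\{v\}$ whose circuits are the minimal sets among the $e\setminus\{v\}$, $e$ a circuit of $\mathcal C$; a contraction of $\mathcal C$ is a clutter obtained from $\mathcal C$ by repeatedly (possibly zero times) contracting vertices. A vertex $v$ is simplicial if for every two distinct circuits $e_1,e_2$ containing $v$ there is a circuit $e_3\subseteq(e_1\cup e_2)\setminus\{v\}$. A face $\sigma$ of a complex $\Delta$ is a shedding face if for every face $\tau\supseteq\sigma$ and every $v\in\sigma$ there is a vertex $w\notin\tau$ such that $(\tau\cup\{w\})\setminus\{v\}$ is a face. For an integer $j$, $\Delta$ is recursively defined to be $j$-decomposable if it is a simplex (possibly $\{\emptyset\}$) or has no faces, or if it has a shedding face $\sigma$ with $\dim\sigma\le j$ such that both $\Delta\setminus\sigma=\{\tau\in\Delta:\sigma\not\subseteq\tau\}$ and $\operatorname{link}_\Delta\sigma$ are $j$-decomposable. $\Delta$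 is shellable if its facets can be ordered $\sigma_1,\dots,\sigma_m$ so that for each $i\ge2$ the intersection of $\sigma_i$ with the complex generated by $\sigma_1,\dots,\sigma_{i-1}$ is pure of dimension $\dim\sigma_i-1$. $\Delta$ is Cohen–Macaulay over $R$ if $\tilde H_i(\operatorname{link}_\Delta\sigma;R)=0$ for every face $\sigma$ (including $\emptyset$) and every $i<\dim\operatorname{link}_\Delta\sigma$, and sequentially Cohen–Macaulay over $R$ if for every $d$ the subcomplex generated by its $d$-dimensional faces is Cohen–Macaulay over $R$. **Statement.** Let $\mathcal C$ be a clutter with maximum circuit cardinality $k$ ($k=0$ if there are no circuits). Suppose that every contraction of $\mathcal C$ has, up to singleton circuits, a simplicial vertex; that is, for every contraction $\mathcal D$ of $\mathcal C$ having at least one vertex $x$ with $\{x\}$ independent in $\mathcal D$, there is a simplicial vertex $v$ of $\mathcal D$ with $\{v\}$ independent in $\mathcal D$. Then $I(\mathcal C)$ is $(k-2)$-decomposable, it is shellable, and it is sequentially Cohen–Macaulay over every field and over $\mathbb Z$. -/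

import Mathlib

universe u w

/-- A finite abstract simplicial complex: a finite family of finite sets, closed under passing to
subsets. The void complex `{}` and the complex `{∅}` are both allowed, and a point of `α` need not
span a face. The ambient vertex set is not recorded, since no notion below depends on it. -/
@[ext]
structure FinComplex (α : Type u) where
  faces : Finset (Finset α)
  down_closed : ∀ s ∈ faces, ∀ t, t ⊆ s → t ∈ faces

/-- A clutter on a finite vertex set: a family of subsets (circuits), none of which is contained
in another one. -/
@[ext]
structure Clutter (α : Type u) where
  verts : Finset α
  circuits : Finset (Finset α)
  circuit_subset : ∀ e ∈ circuits, e ⊆ verts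
  antichain : ∀ e₁ ∈ circuits, ∀ e₂ ∈ circuits, e₁ ⊆ e₂ → e₁ = e₂

namespace FinComplex

variable {α : Type u}

/-- The dimension of a face: its cardinality minus one. -/
def faceDim (s : Finset α) : ℤ := (s.card : ℤ) - 1

/-- The dimension of a complex with at least one face: the largest dimension of a face. -/
def dim (K : FinComplex α) : ℤ := (K.faces.sup Finset.card : ℕ) - 1

/-- A facet is a face that is maximal under inclusion. -/
def IsFacet (K : FinComplex α) (s : Finset α) : Prop :=
  s ∈ K.faces ∧ ∀ t ∈ K.faces, s ⊆ t → t = s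

/-- `K` is pure of dimension `d`: it has a face, and all its facets have dimension `d`. -/
def IsPureOfDim (K : FinComplex α) (d : ℤ) : Prop :=
  K.faces.Nonempty ∧ ∀ s, K.IsFacet s → faceDim s = d

/-- The complex `{}` with no face at all. -/
def void : FinComplex α where
  faces := ∅
  down_closed := by simp

variable [DecidableEq α]

/-- The complex generated by a family of sets: all subsets of its members. -/
def generatedBy (S : Finset (Finset α)) : FinComplex α where
  faces := S.biUnion Finset.powerset
  down_closed := by
    intro s hs t hts
    simp only [Finset.mem_biUnion, Finset.mem_powerset] at hs ⊢
    obtain ⟨a, ha, hsa⟩ := hs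
    exact ⟨a, ha, hts.trans hsa⟩

/-- The simplex on the vertex set `s`: all subsets of `s`. For `s = ∅` this is `{∅}`. -/
def simplex (s : Finset α) : FinComplex α := generatedBy {s}

/-- The intersection of two complexes. -/
def inter (K L : FinComplex α) : FinComplex α where
  faces := K.faces ∩ L.faces
  down_closed := by
    intro s hs t hts
    rw [Finset.mem_inter] at hs ⊢
    exact ⟨K.down_closed s hs.1 t hts, L.down_closed s hs.2 t hts⟩

/-- `K \ σ`: remove all faces that contain `σ`. -/
def deletion (K : FinComplex α) (σ : Finset α) : FinComplex α where
  faces := K.faces.filter (fun τ => ¬ σ ⊆ τ)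
  down_closed := by
    intro s hs t hts
    rw [Finset.mem_filter] at hs ⊢
    exact ⟨K.down_closed s hs.1 t hts, fun h => hs.2 (h.trans hts)⟩

/-- The link of `σ` in `K`: the sets `τ` disjoint from `σ` such that `σ ∪ τ` is a face. -/
def link (K : FinComplex α) (σ : Finset α) : FinComplex α where
  faces := K.faces.filter (fun τ => Disjoint σ τ ∧ σ ∪ τ ∈ K.faces)
  down_closed := by
    intro s hs t hts
    rw [Finset.mem_filter] at hs ⊢
    exact ⟨K.down_closed s hs.1 t hts, hs.2.1.mono_right hts,
      K.down_closed _ hs.2.2 _ (Finset.union_subset_union_right hts)⟩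

/-- A shedding face `σ`: for every face `τ` containing `σ` and every `v ∈ σ` there is a vertex
`w ∉ τ` such that `(τ ∪ {w}) \ {v}` is a face. -/
def IsSheddingFace (K : FinComplex α) (σ : Finset α) : Prop :=
  σ ∈ K.faces ∧ ∀ τ ∈ K.faces, σ ⊆ τ → ∀ v ∈ σ, ∃ w, w ∉ τ ∧ (insert w τ).erase v ∈ K.faces

/-- `k`-decomposability of a (not necessarily pure) complex, for an integer `k`: a complex is
`k`-decomposable if it is a simplex (`{∅}` included) or has no face, or if it has a shedding face
`σ` of dimension at most `k` such that both `K \ σ` and the link of `σ` are `k`-decomposable. -/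
inductive IsDecomposable (k : ℤ) : FinComplex α → Prop
  | simplex (s : Finset α) : IsDecomposable k (simplex s)
  | void : IsDecomposable k void
  | shed (K : FinComplex α) (σ : Finset α) (hσ : K.IsSheddingFace σ) (hdim : faceDim σ ≤ k)
      (hdel : IsDecomposable k (K.deletion σ)) (hlink : IsDecomposable k (K.link σ)) :
      IsDecomposable k K

/-- Shellability (not necessarily pure): the facets can be listed without repetition as
`F 0, …, F (m - 1)` such that, for every `i ≥ 1`, the intersection of `F i` with the complex
generated by the earlier facets is pure of dimension `dim (F i) - 1`. -/
def IsShellable (K : FinComplex α) : Prop :=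
  ∃ (m : ℕ) (F : Fin m → Finset α), Function.Injective F ∧
    (∀ s, K.IsFacet s ↔ ∃ i, F i = s) ∧
    ∀ i : Fin m, 0 < (i : ℕ) →
      ((simplex (F i)).inter (generatedBy ((Finset.univ.filter (· < i)).image F))).IsPureOfDim
        (faceDim (F i) - 1)

/-- The pure `d`-skeleton: the complex generated by all faces of dimension `d`. -/
def pureSkeleton (K : FinComplex α) (d : ℤ) : FinComplex α :=
  generatedBy (K.faces.filter (fun s => faceDim s = d))

/-! Reduced simplicial homology is defined through the augmented complex of ordered chains: the
chains of degree `m - 1` are the `R`-linear combinations of all sequences `(x₀, …, x_{m-1})`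
(repetitions allowed) whose set of entries is a face. The empty sequence, for `m = 0`, spans the
chains of degree `-1`. -/

/-- The boundary `∂ (x₀, …, x_m) = ∑ i, (-1)^i (x₀, …, x̂_i, …, x_m)`. -/
noncomputable def boundary (R : Type w) [CommRing R] (α : Type u) (m : ℕ) :
    ((Fin (m + 1) → α) →₀ R) →ₗ[R] ((Fin m → α) →₀ R) :=
  Finsupp.linearCombination R (fun x =>
    ∑ i : Fin (m + 1), Finsupp.single (fun j => x (i.succAbove j)) ((-1 : R) ^ (i : ℕ)))

theorem boundary_comp_boundary (R : Type w) [CommRing R] (α : Type u) (m : ℕ) :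
    boundary R α m ∘ₗ boundary R α (m + 1) = 0 := by
  apply Finsupp.lhom_ext
  intro x r
  simp only [boundary, LinearMap.comp_apply, Finsupp.linearCombination_single, map_smul, map_sum,
    LinearMap.zero_apply]
  convert smul_zero r using 2
  simp only [Finset.smul_sum, Finsupp.smul_single, smul_eq_mul, ← pow_add]
  rw [← Finset.sum_product']
  rw [Finset.univ_product_univ, ← Finset.sum_filter_add_sum_filter_not Finset.univ
    (fun p : Fin (m + 2) × Fin (m + 1) => (p.2 : ℕ) < p.1), add_eq_zero_iff_eq_neg,
    ← Finset.sum_neg_distrib]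
  refine Finset.sum_bij' (fun p hp => (p.2.castSucc, p.1.pred (by
      simp only [Finset.mem_filter, Finset.mem_univ, true_and] at hp
      intro h; rw [h] at hp; simp at hp)))
    (fun p hp => (p.2.succ, p.1.castPred (by
      simp only [Finset.mem_filter, Finset.mem_univ, true_and] at hp
      intro h; rw [h] at hp; simp at hp; omega))) ?_ ?_ ?_ ?_ ?_
  · rintro ⟨i, j⟩ h
    simp at h ⊢; omega
  · rintro ⟨i, j⟩ h
    simp at h ⊢; omega
  · rintro ⟨i, j⟩ h; simp
  · rintro ⟨i, j⟩ h; simp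
  · rintro ⟨i, j⟩ h
    simp only [Finset.mem_filter, Finset.mem_univ, true_and] at h
    rw [← Finsupp.single_neg]
    congr 1
    · funext l
      congr 1
      ext
      simp only [Fin.succAbove, Fin.lt_def, Fin.val_castSucc, Fin.val_pred]
      split_ifs <;> simp_all <;> omega
    · obtain ⟨i, rfl⟩ := Fin.exists_succ_eq.2 (show i ≠ 0 by rintro rfl; simp at h)
      simp [pow_add, mul_comm]

/-- The ordered chains of `K` in degree `m - 1`. -/
def chains (R : Type w) [CommRing R] (K : FinComplex α) (m : ℕ) :
    Submodule R ((Fin m → α) →₀ R) :=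
  Finsupp.supported R R {x | Finset.univ.image x ∈ K.faces}

/-- The cycles in degree `m - 1`; every chain of degree `-1` is a cycle. -/
noncomputable def cycles (R : Type w) [CommRing R] (K : FinComplex α) :
    (m : ℕ) → Submodule R ((Fin m → α) →₀ R)
  | 0 => K.chains R 0
  | m + 1 => K.chains R (m + 1) ⊓ LinearMap.ker (boundary R α m)

/-- The boundaries in degree `m - 1`. -/
noncomputable def boundaries (R : Type w) [CommRing R] (K : FinComplex α) (m : ℕ) :
    Submodule R ((Fin m → α) →₀ R) :=
  (K.chains R (m + 1)).map (boundary R α m)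

theorem boundaries_le_cycles (R : Type w) [CommRing R] (K : FinComplex α) (m : ℕ) :
    K.boundaries R m ≤ K.cycles R m := by
  have h : K.boundaries R m ≤ K.chains R m := by
    rw [boundaries, chains, Finsupp.supported_eq_span_single, Submodule.map_span,
      Submodule.span_le]
    rintro _ ⟨_, ⟨x, hx, rfl⟩, rfl⟩
    simp only [boundary, Finsupp.linearCombination_single, one_smul]
    refine Submodule.sum_mem _ fun i _ => ?_
    refine Finsupp.single_mem_supported R _ ?_
    refine K.down_closed _ hx _ ?_
    intro a ha
    obtain ⟨j, -, rfl⟩ := Finset.mem_image.1 ha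
    exact Finset.mem_image_of_mem x (Finset.mem_univ _)
  cases m with
  | zero => exact h
  | succ m =>
    refine le_inf h ?_
    rintro _ ⟨y, -, rfl⟩
    exact LinearMap.congr_fun (boundary_comp_boundary R α m) y

/-- The reduced homology `Z ⧸ B` of `K` with coefficients in `R`, in degree `m - 1`, as the image
of the cycles `Z` in the quotient of all chains by the boundaries `B`. -/
noncomputable def reducedHomology (R : Type w) [CommRing R] (K : FinComplex α) (m : ℕ) :
    Submodule R (((Fin m → α) →₀ R) ⧸ K.boundaries R m) :=
  (K.cycles R m).map (K.boundaries R m).mkQ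

/-- `K` is Cohen–Macaulay over `R`: for every face `σ` (the empty face included), the reduced
homology of the link of `σ` vanishes in all degrees below the dimension of the link. -/
def IsCohenMacaulay (R : Type w) [CommRing R] (K : FinComplex α) : Prop :=
  ∀ σ ∈ K.faces, ∀ m : ℕ, (m : ℤ) - 1 < (K.link σ).dim →
    (K.link σ).reducedHomology R m = ⊥

/-- `K` is sequentially Cohen–Macaulay over `R`: all its pure skeleta are Cohen–Macaulay. -/
def IsSequentiallyCohenMacaulay (R : Type w) [CommRing R] (K : FinComplex α) : Prop :=
  ∀ d : ℤ, (K.pureSkeleton d).IsCohenMacaulay R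

end FinComplex

namespace Clutter

variable {α : Type u}

/-- The largest cardinality of a circuit (`0` if there is no circuit). -/
def maxCircuitCard (C : Clutter α) : ℕ := C.circuits.sup Finset.card

/-- An independent set: a set of vertices that contains no circuit. -/
def IsIndependent (C : Clutter α) (s : Finset α) : Prop :=
  s ⊆ C.verts ∧ ∀ e ∈ C.circuits, ¬ e ⊆ s

variable [DecidableEq α]

/-- The independence complex: its faces are the independent sets. -/
def independenceComplex (C : Clutter α) : FinComplex α where
  faces := C.verts.powerset.filter (fun s => ∀ e ∈ C.circuits, ¬ e ⊆ s)
  down_closed := by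
    intro s hs t hts
    rw [Finset.mem_filter, Finset.mem_powerset] at hs ⊢
    exact ⟨hts.trans hs.1, fun e he h => hs.2 e he (h.trans hts)⟩

/-- The inclusion-minimal members of a family of sets. -/
def minimalSets (S : Finset (Finset α)) : Finset (Finset α) :=
  S.filter (fun e => ∀ e' ∈ S, e' ⊆ e → e' = e)

/-- The contraction `C / v`: on the vertex set `V \ {v}`, its circuits are the minimal sets among
the `e \ {v}`, for `e` a circuit of `C`. -/
def contract (C : Clutter α) (v : α) : Clutter α where
  verts := C.verts.erase v
  circuits := minimalSets (C.circuits.image (fun e => e.erase v))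
  circuit_subset := by
    intro e he
    obtain ⟨e', he', rfl⟩ := Finset.mem_image.1 (Finset.mem_filter.1 he).1
    exact Finset.erase_subset_erase v (C.circuit_subset e' he')
  antichain := by
    intro e₁ h₁ e₂ h₂ h
    exact (Finset.mem_filter.1 h₂).2 e₁ (Finset.mem_filter.1 h₁).1 h

/-- `C.IsContraction D`: the clutter `D` is obtained from `C` by repeated (possibly zero)
contractions of vertices. -/
inductive IsContraction (C : Clutter α) : Clutter α → Prop
  | refl : IsContraction C C
  | step (D : Clutter α) (v : α) (hD : IsContraction C D) (hv : v ∈ D.verts) :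
      IsContraction C (D.contract v)

/-- A simplicial vertex `v`: for every two distinct circuits `e₁`, `e₂` that contain `v`, there is
a circuit contained in `(e₁ ∪ e₂) \ {v}`. -/
def IsSimplicialVertex (C : Clutter α) (v : α) : Prop :=
  v ∈ C.verts ∧ ∀ e₁ ∈ C.circuits, ∀ e₂ ∈ C.circuits, e₁ ≠ e₂ → v ∈ e₁ → v ∈ e₂ →
    ∃ e₃ ∈ C.circuits, e₃ ⊆ (e₁ ∪ e₂).erase v

end Clutter

/-! ### Faces of links, deletions and generated complexes -/

namespace FinComplex

variable {α : Type u} [DecidableEq α]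

/-! Let `v` be simplicial with `{v}` independent. For a circuit `e ∋ v`, a face `τ ⊇ e \ {v}`
contains no `f \ {v}` for another circuit `f ∋ v`: otherwise simpliciality would put a circuit
inside `τ`. Hence any `x ∈ e \ {v}` can be exchanged for `v` in `τ`, so `e \ {v}` is a shedding
face, of dimension `|e| - 2`. For the same reason, deleting these faces for other circuits leaves
the link of `e \ {v}` unchanged. Once all are deleted, a cone with apex `v` over the link of `v`
remains (`IsSimplicialVertex.isDecomposable`). All links that occur are independence complexes of
contractions (`exists_isContraction_link`), so induction on the number of vertices gives
decomposability.

A shelling of `K \ σ`, followed by the joins of `σ` with a shelling of its link, shells `K`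
(`IsDecomposable.exists_shellingList`).

For the Cohen–Macaulay property, shellings survive links and the removal of small facets
(`ShellingList.map_sdiff_filter`). In the degrees that matter, links in pure skeleta are complexes
shelled in this way (`mem_link_pureSkeleton_iff`). Attaching facets one at a time keeps the low
homology zero (`ShellingList.cycles_le_boundaries`), by a cone operator that works over any
commutative ring. -/

theorem mem_generatedBy {S : Finset (Finset α)} {s : Finset α} :
    s ∈ (generatedBy S).faces ↔ ∃ F ∈ S, s ⊆ F := by
  simp [generatedBy]

theorem mem_simplex {s t : Finset α} : t ∈ (simplex s).faces ↔ t ⊆ s := by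
  simp [simplex, mem_generatedBy]

theorem mem_link {K : FinComplex α} {σ τ : Finset α} :
    τ ∈ (K.link σ).faces ↔ Disjoint σ τ ∧ σ ∪ τ ∈ K.faces := by
  simp only [link, Finset.mem_filter, and_iff_right_iff_imp]
  exact fun h => K.down_closed _ h.2 _ Finset.subset_union_right

theorem mem_deletion {K : FinComplex α} {σ τ : Finset α} :
    τ ∈ (K.deletion σ).faces ↔ τ ∈ K.faces ∧ ¬ σ ⊆ τ := by
  simp [deletion]

theorem mem_inter {K L : FinComplex α} {s : Finset α} :
    s ∈ (K.inter L).faces ↔ s ∈ K.faces ∧ s ∈ L.faces := by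
  simp [inter]

omit [DecidableEq α] in
theorem ext_mem {K L : FinComplex α} (h : ∀ s, s ∈ K.faces ↔ s ∈ L.faces) : K = L :=
  FinComplex.ext (Finset.ext h)

omit [DecidableEq α] in
theorem exists_isFacet_superset (K : FinComplex α) {s : Finset α} (hs : s ∈ K.faces) :
    ∃ F, K.IsFacet F ∧ s ⊆ F := by
  obtain ⟨F, hsF, hF⟩ := K.faces.exists_le_maximal hs
  exact ⟨F, ⟨hF.prop, fun t ht h => (hF.eq_of_le ht h).symm⟩, hsF⟩

theorem link_empty (K : FinComplex α) : K.link ∅ = K :=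
  ext_mem fun s => by simp [mem_link]

theorem link_link_singleton (K : FinComplex α) {σ : Finset α} {a : α} (ha : a ∉ σ) :
    (K.link σ).link {a} = K.link (insert a σ) := by
  refine ext_mem fun s => ?_
  simp only [mem_link, Finset.disjoint_union_right, Finset.disjoint_insert_left,
    Finset.disjoint_singleton_left, Finset.disjoint_singleton_right]
  rw [show σ ∪ ({a} ∪ s) = insert a σ ∪ s by ext; simp]
  tauto

/-! ### Shelling lists -/

/-- A list of sets, the latest one first, each of which meets the complex generated by the earlier
ones in a complex generated by sets with one element less. -/
def ShellingList : List (Finset α) → Prop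
  | [] => True
  | F :: l => ShellingList l ∧ ∀ G ∈ l, ∃ x ∈ F, x ∉ G ∧ ∃ H ∈ l, F.erase x ⊆ H

theorem ShellingList.nodup : ∀ {l : List (Finset α)}, ShellingList l → l.Nodup
  | [], _ => List.nodup_nil
  | F :: l, h => List.nodup_cons.2
      ⟨fun hF => by obtain ⟨x, hx, hx', -⟩ := h.2 F hF; exact hx' hx, h.1.nodup⟩

/-- Indexed form of the recursive condition; a larger index means an earlier place in the shelling.
-/
theorem ShellingList.getElem : ∀ {l : List (Finset α)}, ShellingList l →
    ∀ (i j : ℕ) (hj : j < l.length) (hij : i < j),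
      ∃ x ∈ l[i], x ∉ l[j] ∧ ∃ (k : ℕ) (hk : k < l.length), i < k ∧ l[i].erase x ⊆ l[k]
  | [], _, i, j, hj, _ => by simp at hj
  | F :: l, h, 0, j + 1, hj, _ => by
    obtain ⟨x, hx, hx', H, hH, hsub⟩ := h.2 (l[j]'(by simpa using hj)) (List.getElem_mem _)
    obtain ⟨k, hk, rfl⟩ := List.getElem_of_mem hH
    exact ⟨x, hx, by simpa using hx', k + 1, by simpa using hk, by simp, by simpa using hsub⟩
  | F :: l, h, i + 1, j + 1, hj, hij => by
    obtain ⟨x, hx, hx', k, hk, hik, hsub⟩ :=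
      h.1.getElem i j (by simpa using hj) (by omega)
    exact ⟨x, by simpa using hx, by simpa using hx', k + 1, by simpa using hk, by omega,
      by simpa using hsub⟩

theorem ShellingList.isShellable {K : FinComplex α} {l : List (Finset α)} (hl : ShellingList l)
    (hK : ∀ s, K.IsFacet s ↔ s ∈ l) : K.IsShellable := by
  -- The list has the latest facet first, so the indices are reversed.
  refine ⟨l.length, fun i => l[(Fin.rev i : ℕ)], ?_, ?_, ?_⟩
  · intro i j h
    have := (hl.nodup.getElem_inj_iff).1 h
    exact Fin.rev_injective (Fin.ext this)
  · intro s
    rw [hK, List.mem_iff_getElem]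
    constructor
    · rintro ⟨i, hi, rfl⟩
      exact ⟨Fin.rev ⟨i, hi⟩, by simp⟩
    · rintro ⟨i, rfl⟩
      exact ⟨_, (Fin.rev i).2, rfl⟩
  · intro i hi
    have key : ∀ s, s ∈ ((simplex l[(Fin.rev i : ℕ)]).inter (generatedBy
        ((Finset.univ.filter (· < i)).image fun i : Fin l.length => l[(Fin.rev i : ℕ)]))).faces ↔
        s ⊆ l[(Fin.rev i : ℕ)] ∧ ∃ j < i, s ⊆ l[(Fin.rev j : ℕ)] := by
      intro s
      simp [mem_inter, mem_simplex, mem_generatedBy]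
    refine ⟨⟨∅, ?_⟩, ?_⟩
    · rw [key]
      exact ⟨by simp, ⟨0, i.pos⟩, Fin.lt_def.2 hi, by simp⟩
    · rintro s ⟨hs, hmax⟩
      obtain ⟨hsi, j, hji, hsj⟩ := (key s).1 hs
      obtain ⟨x, hx, hx', k, hk, hik, hsub⟩ := hl.getElem (Fin.rev i) (Fin.rev j) (Fin.rev j).2
        (Fin.lt_def.1 (Fin.rev_lt_rev.2 hji))
      have hsx : s ⊆ (l[(Fin.rev i : ℕ)]).erase x :=
        Finset.subset_erase.2 ⟨hsi, fun h => hx' (hsj h)⟩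
      -- The facet without `x` is itself in the intersection, so the maximal face `s` equals it.
      have hmem := hmax _ ((key _).2 ⟨Finset.erase_subset _ _, Fin.rev ⟨k, hk⟩, ?_, ?_⟩) hsx
      · rw [← hmem]
        simp only [faceDim]
        rw [Finset.card_erase_of_mem hx, Nat.cast_sub (Finset.card_pos.2 ⟨x, hx⟩)]
        simp
      · rw [← Fin.rev_lt_rev, Fin.rev_rev]
        exact Fin.lt_def.2 hik
      · simpa using hsub

/-- Against an earlier `σ ∪ G`, the shelling of the link supplies the exchange. A `G` in `l₀` misses
some `x ∈ σ`, and the last hypothesis supplies the member of `l₀` needed for this `x`. -/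
theorem ShellingList.append_map_union {σ : Finset α} {l₀ : List (Finset α)} (h₀ : ShellingList l₀)
    (hσ₀ : ∀ G ∈ l₀, ¬ σ ⊆ G) : ∀ {l : List (Finset α)}, ShellingList l →
    (∀ G ∈ l, Disjoint σ G) → (∀ G ∈ l, ∀ x ∈ σ, ∃ H ∈ l₀, (σ ∪ G).erase x ⊆ H) →
    ShellingList (l.map (σ ∪ ·) ++ l₀)
  | [], _, _, _ => h₀
  | F :: l, h, hd, hx => by
    refine ⟨append_map_union h₀ hσ₀ h.1 (fun G hG => hd G (by simp [hG]))
      fun G hG => hx G (by simp [hG]), fun G hG => ?_⟩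
    have hF := hd F (by simp)
    rcases List.mem_append.1 hG with hG | hG
    · obtain ⟨G, hG', rfl⟩ := List.mem_map.1 hG
      obtain ⟨x, hxF, hxG, H, hH, hsub⟩ := h.2 G hG'
      have hxσ : x ∉ σ := fun h => Finset.disjoint_left.1 hF h hxF
      refine ⟨x, by simp [hxF], by simp [hxG, hxσ], σ ∪ H, ?_, ?_⟩
      · exact List.mem_append_left _ (List.mem_map_of_mem hH)
      · rw [Finset.erase_union_distrib, Finset.erase_eq_of_notMem hxσ]
        exact Finset.union_subset_union_right hsub
    · obtain ⟨x, hxσ, hxG⟩ := Finset.not_subset.1 (hσ₀ G hG)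
      obtain ⟨H, hH, hsub⟩ := hx F (by simp) x hxσ
      exact ⟨x, by simp [hxσ], hxG, H, by simp [hH], hsub⟩

/-! ### Decomposable complexes are shellable -/

/-- For a shedding face `σ`, the facets are those of `K \ σ` and those containing `σ`. -/
theorem IsSheddingFace.isFacet_iff {K : FinComplex α} {σ : Finset α} (hσ : K.IsSheddingFace σ)
    (s : Finset α) : K.IsFacet s ↔
      (K.deletion σ).IsFacet s ∨ ∃ G, (K.link σ).IsFacet G ∧ σ ∪ G = s := by
  constructor
  · rintro ⟨hs, hmax⟩
    by_cases h : σ ⊆ s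
    · refine .inr ⟨s \ σ, ⟨?_, fun t ht hst => ?_⟩, Finset.union_sdiff_of_subset h⟩
      · exact mem_link.2 ⟨Finset.disjoint_sdiff, by rwa [Finset.union_sdiff_of_subset h]⟩
      · obtain ⟨hd, ht⟩ := mem_link.1 ht
        rw [← hmax _ ht (by rw [← Finset.union_sdiff_of_subset h]; gcongr),
          Finset.union_sdiff_cancel_left hd]
    · exact .inl ⟨mem_deletion.2 ⟨hs, h⟩, fun t ht => hmax t (mem_deletion.1 ht).1⟩
  · rintro (⟨hs, hmax⟩ | ⟨G, ⟨hG, hmax⟩, rfl⟩)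
    · obtain ⟨hsK, hσs⟩ := mem_deletion.1 hs
      refine ⟨hsK, fun t ht hst => ?_⟩
      by_cases h : σ ⊆ t
      -- Exchanging `v ∈ σ \ s` for `w` in `t` gives a face of `K \ σ` that contains `s` and the new
      -- element `w`, against maximality of `s`.
      · obtain ⟨v, hv, hvs⟩ := Finset.not_subset.1 hσs
        obtain ⟨w, hw, hwt⟩ := hσ.2 t ht h v hv
        have hwv : w ≠ v := fun h' => hw (h' ▸ h hv)
        have := hmax _ (mem_deletion.2 ⟨hwt, fun h' => by simpa using h' hv⟩)
          (Finset.subset_erase.2 ⟨hst.trans (Finset.subset_insert _ _), hvs⟩)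
        exact absurd (hst (this ▸ by simp [hwv])) hw
      · exact hmax t (mem_deletion.2 ⟨ht, h⟩) hst
    · obtain ⟨hd, hG⟩ := mem_link.1 hG
      refine ⟨hG, fun t ht hst => ?_⟩
      have hσt := Finset.subset_union_left.trans hst
      rw [← hmax (t \ σ) (mem_link.2 ⟨Finset.disjoint_sdiff, ?_⟩) ?_,
        Finset.union_sdiff_of_subset hσt]
      · rwa [Finset.union_sdiff_of_subset hσt]
      · exact Finset.subset_sdiff.2 ⟨Finset.subset_union_right.trans hst, hd.symm⟩

theorem IsDecomposable.exists_shellingList {k : ℤ} {K : FinComplex α} (h : K.IsDecomposable k) :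
    ∃ l, ShellingList l ∧ ∀ s, K.IsFacet s ↔ s ∈ l := by
  induction h with
  | simplex s =>
    refine ⟨[s], by simp [ShellingList], fun t => ?_⟩
    simp only [IsFacet, mem_simplex, List.mem_singleton]
    constructor
    · exact fun h => (h.2 s subset_rfl h.1).symm
    · rintro rfl
      exact ⟨subset_rfl, fun u hu h => hu.antisymm h⟩
  | void => exact ⟨[], trivial, fun s => by simp [IsFacet, FinComplex.void]⟩
  | shed K σ hσ _ _ _ ihd ihl =>
    obtain ⟨l₀, h₀, hl₀⟩ := ihd
    obtain ⟨l, h, hl⟩ := ihl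
    refine ⟨l.map (σ ∪ ·) ++ l₀, h₀.append_map_union ?_ h ?_ ?_, fun s => ?_⟩
    · exact fun G hG => (mem_deletion.1 ((hl₀ G).2 hG).1).2
    · exact fun G hG => (mem_link.1 ((hl G).2 hG).1).1
    · intro G hG x hx
      obtain ⟨F, hF, hsub⟩ := (K.deletion σ).exists_isFacet_superset (s := (σ ∪ G).erase x)
        (mem_deletion.2 ⟨K.down_closed _ (mem_link.1 ((hl G).2 hG).1).2 _
          (Finset.erase_subset _ _), fun h => by simpa using h hx⟩)
      exact ⟨F, (hl₀ F).1 hF, hsub⟩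
    · rw [hσ.isFacet_iff]
      simp [hl, hl₀, or_comm]

/-- Links, and the removal of small members, preserve shelling lists. -/
theorem ShellingList.map_sdiff_filter (σ : Finset α) (n : ℕ) :
    ∀ {l : List (Finset α)}, ShellingList l → (∀ F ∈ l, ∀ G ∈ l, F ⊆ G → F = G) →
    ShellingList ((l.filter fun F => σ ⊆ F ∧ n ≤ F.card).map (· \ σ))
  | [], _, _ => trivial
  | F :: l, h, hl => by
    have ih := map_sdiff_filter σ n h.1 fun F hF G hG => hl F (by simp [hF]) G (by simp [hG])
    by_cases hF : σ ⊆ F ∧ n ≤ F.card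
    · rw [List.filter_cons_of_pos (by simpa using hF), List.map_cons]
      refine ⟨ih, fun G hG => ?_⟩
      obtain ⟨G, hG', rfl⟩ := List.mem_map.1 hG
      obtain ⟨hG, hσG⟩ := List.mem_filter.1 hG'
      simp only [decide_eq_true_eq] at hσG
      obtain ⟨x, hxF, hxG, H, hH, hsub⟩ := h.2 G hG
      have hxσ : x ∉ σ := fun h => hxG (hσG.1 h)
      refine ⟨x, by simp [hxF, hxσ], by simp [hxG], H \ σ, List.mem_map_of_mem
        (List.mem_filter.2 ⟨hH, ?_⟩), ?_⟩
      · simp only [decide_eq_true_eq]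
        refine ⟨(Finset.subset_erase.2 ⟨hF.1, hxσ⟩).trans hsub, ?_⟩
        -- A member `H ⊇ F \ {x}` with fewer than `n ≤ |F|` elements would equal `F \ {x}`, which
        -- the antichain condition forbids.
        by_contra! hn
        have hc := Finset.card_erase_of_mem hxF
        have hHF : F.erase x = H := Finset.eq_of_subset_of_card_le hsub (by omega)
        have := hl H (by simp [hH]) F (by simp) (hHF ▸ Finset.erase_subset _ _)
        rw [this] at hn
        omega
      · rw [← Finset.erase_sdiff_comm]
        exact Finset.sdiff_subset_sdiff hsub subset_rfl
    · rwa [List.filter_cons_of_neg (by simpa using hF)]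

/-! ### Homology -/

/-- The cone operator `(x₀, …, x_{m-1}) ↦ (y, x₀, …, x_{m-1})`. -/
noncomputable def coneMap (R : Type w) [CommRing R] (y : α) (m : ℕ) :
    ((Fin m → α) →₀ R) →ₗ[R] ((Fin (m + 1) → α) →₀ R) :=
  Finsupp.lmapDomain R R (Fin.cons (α := fun _ => α) y)

variable {R : Type w} [CommRing R]

omit [DecidableEq α] in
theorem boundary_coneMap_zero (y : α) (z : (Fin 0 → α) →₀ R) :
    boundary R α 0 (coneMap R y 0 z) = z := by
  induction z using Finsupp.induction_linear with
  | zero => simp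
  | add f g hf hg => simp only [map_add, hf, hg]
  | single x r =>
    simp only [coneMap, Finsupp.lmapDomain_apply, Finsupp.mapDomain_single, boundary,
      Finsupp.linearCombination_single, Fin.sum_univ_succ, Fin.sum_univ_zero]
    simp

omit [DecidableEq α] in
-- The cone operator is a contracting homotopy. Repeated entries are allowed, so it makes no
-- difference whether `y` already occurs.
theorem boundary_coneMap_succ (y : α) (m : ℕ) (z : (Fin (m + 1) → α) →₀ R) :
    boundary R α (m + 1) (coneMap R y (m + 1) z) = z - coneMap R y m (boundary R α m z) := by
  induction z using Finsupp.induction_linear with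
  | zero => simp
  | add f g hf hg => simp only [map_add, hf, hg]; abel
  | single x r =>
    simp only [coneMap, Finsupp.lmapDomain_apply, Finsupp.mapDomain_single, boundary,
      Finsupp.linearCombination_single, Fin.sum_univ_succ (n := m + 1), Finsupp.mapDomain_smul,
      Finsupp.mapDomain_finsetSum, smul_add]
    rw [sub_eq_add_neg, ← smul_neg, ← Finset.sum_neg_distrib]
    congr 1
    · simp
    · congr 1
      refine Finset.sum_congr rfl fun i _ => ?_
      rw [← Finsupp.single_neg]
      congr 1
      · funext j
        refine Fin.cases ?_ (fun j => ?_) j <;> simp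
      · simp [pow_succ]

theorem mem_chains {K : FinComplex α} {m : ℕ} {z : (Fin m → α) →₀ R} :
    z ∈ K.chains R m ↔ ∀ x ∈ z.support, Finset.univ.image x ∈ K.faces := by
  simp [chains, Finsupp.mem_supported, Set.subset_def]

theorem coneMap_mem_chains {K L : FinComplex α} {y : α} {m : ℕ} {z : (Fin m → α) →₀ R}
    (hz : z ∈ K.chains R m) (h : ∀ s ∈ K.faces, insert y s ∈ L.faces) :
    coneMap R y m z ∈ L.chains R (m + 1) := by
  rw [mem_chains] at hz ⊢
  intro x hx
  obtain ⟨x', hx', rfl⟩ := Finset.mem_image.1 (Finsupp.mapDomain_support hx)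
  convert h _ (hz x' hx')
  ext a
  simp [Fin.exists_fin_succ, eq_comm]

theorem boundary_mem_chains {K : FinComplex α} {m : ℕ} {z : (Fin (m + 1) → α) →₀ R}
    (hz : z ∈ K.chains R (m + 1)) : boundary R α m z ∈ K.chains R m := by
  have h := K.boundaries_le_cycles R m ⟨z, hz, rfl⟩
  cases m with
  | zero => exact h
  | succ m => exact h.1

theorem chains_mono {K L : FinComplex α} (h : K.faces ⊆ L.faces) (m : ℕ) :
    K.chains R m ≤ L.chains R m :=
  Finsupp.supported_mono fun _ hx => h hx

theorem chains_inter {K L : FinComplex α} {m : ℕ} {z : (Fin m → α) →₀ R}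
    (hK : z ∈ K.chains R m) (hL : z ∈ L.chains R m) : z ∈ (K.inter L).chains R m := by
  rw [mem_chains] at *
  exact fun x hx => mem_inter.2 ⟨hK x hx, hL x hx⟩

theorem exists_chains_add {K L M : FinComplex α} (h : ∀ s ∈ M.faces, s ∈ K.faces ∨ s ∈ L.faces)
    {m : ℕ} {z : (Fin m → α) →₀ R} (hz : z ∈ M.chains R m) :
    ∃ a ∈ K.chains R m, ∃ b ∈ L.chains R m, a + b = z := by
  classical
  refine ⟨_, ?_, _, ?_, Finsupp.filter_add_filter_not z fun x => Finset.univ.image x ∈ K.faces⟩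
  · rw [mem_chains]
    intro x hx
    rw [Finsupp.support_filter, Finset.mem_filter] at hx
    exact hx.2
  · rw [mem_chains]
    intro x hx
    rw [Finsupp.support_filter, Finset.mem_filter] at hx
    exact (h _ (mem_chains.1 hz x hx.1)).resolve_left hx.2

theorem cycles_le_chains (K : FinComplex α) (m : ℕ) : K.cycles R m ≤ K.chains R m := by
  cases m with
  | zero => exact le_rfl
  | succ m => exact inf_le_left

/-- Attaching a simplex along a subcomplex with cone point `y` creates no homology. -/
theorem cycles_le_boundaries_of_cone {K M : FinComplex α} {F : Finset α} {y : α} {m : ℕ}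
    (hM : ∀ s, s ∈ M.faces ↔ s ⊆ F ∨ s ∈ K.faces) (hy : y ∈ F)
    (hcone : ∀ s ∈ K.faces, s ⊆ F → insert y s ∈ K.faces)
    (hK : K.cycles R m ≤ K.boundaries R m) : M.cycles R m ≤ M.boundaries R m := by
  intro z hz
  have hKM : K.faces ⊆ M.faces := fun s hs => (hM s).2 (.inr hs)
  have hFM : (simplex F).faces ⊆ M.faces := fun s hs => (hM s).2 (.inl (mem_simplex.1 hs))
  obtain ⟨a, ha, b, hb, rfl⟩ := exists_chains_add (K := K) (L := simplex F)
    (fun s hs => by rw [mem_simplex]; exact ((hM s).1 hs).symm) (cycles_le_chains M m hz)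
  have hcb : coneMap R y m b ∈ M.chains R (m + 1) := chains_mono hFM _ <|
    coneMap_mem_chains hb fun s hs => mem_simplex.2 (Finset.insert_subset hy (mem_simplex.1 hs))
  -- The witness is `c = a + cone (∂ b)`. As `∂ b = -∂ a` lies both in `K` and in the simplex,
  -- `hcone` keeps its cone in `K`. In the lowest degree `c = a`.
  suffices h : ∃ c ∈ K.cycles R m, a + b = c + boundary R α m (coneMap R y m b) by
    obtain ⟨c, hc, h⟩ := h
    rw [h]
    exact add_mem (Submodule.map_mono (chains_mono hKM _) (hK hc)) ⟨_, hcb, rfl⟩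
  cases m with
  | zero => exact ⟨a, ha, by rw [boundary_coneMap_zero]⟩
  | succ m =>
    have hab : boundary R α m a + boundary R α m b = 0 := by
      rw [← map_add]; exact hz.2
    have hbK : boundary R α m b ∈ K.chains R m := by
      rw [eq_neg_of_add_eq_zero_right hab]
      exact neg_mem (boundary_mem_chains ha)
    have hbI := chains_inter hbK (boundary_mem_chains hb)
    refine ⟨a + coneMap R y m (boundary R α m b), ⟨add_mem ha (coneMap_mem_chains hbI ?_), ?_⟩, ?_⟩
    · exact fun s hs => hcone s (mem_inter.1 hs).1 (mem_simplex.1 (mem_inter.1 hs).2)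
    · have hbb := LinearMap.congr_fun (boundary_comp_boundary R α m)
        (coneMap R y (m + 1) b)
      rw [LinearMap.comp_apply, boundary_coneMap_succ, LinearMap.zero_apply, map_sub,
        sub_eq_zero] at hbb
      rw [SetLike.mem_coe, LinearMap.mem_ker, map_add, ← hbb, hab]
    · rw [boundary_coneMap_succ]
      abel

/-- A sequence of length `m` has at most `m` distinct entries, so larger faces are invisible to the
cycles. Boundaries come from sequences one longer. -/
theorem cycles_congr {K L : FinComplex α} {m : ℕ}
    (h : ∀ s : Finset α, s.card ≤ m → (s ∈ K.faces ↔ s ∈ L.faces)) :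
    K.cycles R m = L.cycles R m := by
  have hc : K.chains R m = L.chains R m := by
    ext z
    simp only [mem_chains]
    refine forall₂_congr fun x _ => h _ (Finset.card_image_le.trans (by simp))
  cases m with
  | zero => exact hc
  | succ m => simp only [cycles, hc]

theorem boundaries_congr {K L : FinComplex α} {m : ℕ}
    (h : ∀ s : Finset α, s.card ≤ m + 1 → (s ∈ K.faces ↔ s ∈ L.faces)) :
    K.boundaries R m = L.boundaries R m := by
  have hc : K.chains R (m + 1) = L.chains R (m + 1) := by
    ext z
    simp only [mem_chains]
    refine forall₂_congr fun x _ => h _ (Finset.card_image_le.trans (by simp))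
  simp only [boundaries, hc]

/-- A complex that is shelled by sets with more than `m` elements has no reduced homology in
degree `m - 1`. -/
theorem ShellingList.cycles_le_boundaries {m : ℕ} : ∀ {l : List (Finset α)}, ShellingList l →
    (∀ F ∈ l, m < F.card) →
    (generatedBy l.toFinset).cycles R m ≤ (generatedBy l.toFinset).boundaries R m
  | [], _, _ => by
    intro z hz
    have : z = 0 := by
      have h := mem_chains.1 (cycles_le_chains _ m hz)
      rw [← Finsupp.support_eq_empty, Finset.eq_empty_iff_forall_notMem]
      intro x hx
      simpa [mem_generatedBy] using h x hx
    rw [this]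
    exact zero_mem _
  | F :: l, h, hm => by
    have ih := h.1.cycles_le_boundaries fun F hF => hm F (by simp [hF])
    have hM : ∀ s, s ∈ (generatedBy (F :: l).toFinset).faces ↔
        s ⊆ F ∨ s ∈ (generatedBy l.toFinset).faces := by simp [mem_generatedBy]
    by_cases hA : ∀ y ∈ F, F.erase y ∈ (generatedBy l.toFinset).faces
    · rw [cycles_congr (L := generatedBy l.toFinset) fun s hs => ?_]
      · exact ih.trans (Submodule.map_mono (chains_mono (fun s hs => (hM s).2 (.inr hs)) _))
      · rw [hM]
        refine ⟨fun h' => h'.elim (fun hsF => ?_) id, .inr⟩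
        obtain ⟨y, hy, hys⟩ := Finset.exists_mem_notMem_of_card_lt_card
          (hs.trans_lt (hm F (by simp)))
        exact down_closed _ _ (hA y hy) _ (Finset.subset_erase.2 ⟨hsF, hys⟩)
    -- If `F \ {y}` is missing, the subcomplex along which `F` is attached is a cone with apex `y`:
    -- each of its faces lies in some old `F \ {x}`, where `x ≠ y`.
    · push Not at hA
      obtain ⟨y, hy, hyl⟩ := hA
      refine cycles_le_boundaries_of_cone hM hy (fun s hs hsF => ?_) ih
      obtain ⟨G, hG, hsG⟩ := mem_generatedBy.1 hs
      obtain ⟨x, hx, hxG, H, hH, hsub⟩ := h.2 G (by simpa using hG)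
      have hxl : F.erase x ∈ (generatedBy l.toFinset).faces :=
        mem_generatedBy.2 ⟨H, by simpa using hH, hsub⟩
      have hxy : x ≠ y := by rintro rfl; exact hyl hxl
      refine down_closed _ _ hxl _ (Finset.subset_erase.2 ⟨Finset.insert_subset hy hsF, ?_⟩)
      simp only [Finset.mem_insert, not_or]
      exact ⟨hxy, fun h' => hxG (hsG h')⟩

/-! ### Sequential Cohen–Macaulayness from a shelling -/

theorem mem_pureSkeleton {K : FinComplex α} {d : ℤ} {s : Finset α} :
    s ∈ (K.pureSkeleton d).faces ↔ ∃ t ∈ K.faces, (t.card : ℤ) = d + 1 ∧ s ⊆ t := by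
  simp only [pureSkeleton, mem_generatedBy, Finset.mem_filter, faceDim, and_assoc, sub_eq_iff_eq_add]

/-- Up to sets of the relevant size, links in a pure skeleton are generated by the traces of the
large facets. -/
theorem mem_link_pureSkeleton_iff {K : FinComplex α} {l : List (Finset α)}
    (hl : ∀ s, K.IsFacet s ↔ s ∈ l) {d : ℤ} {n : ℕ} (hd : d + 1 = n) {σ s : Finset α}
    (hs : σ.card + s.card ≤ n) : s ∈ ((K.pureSkeleton d).link σ).faces ↔
      s ∈ (generatedBy ((l.filter fun F => σ ⊆ F ∧ n ≤ F.card).map (· \ σ)).toFinset).faces := by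
  simp only [mem_link, mem_pureSkeleton, mem_generatedBy, List.mem_toFinset, List.mem_map,
    List.mem_filter, decide_eq_true_eq, hd, Nat.cast_inj]
  constructor
  · rintro ⟨hdisj, t, ht, htn, hst⟩
    obtain ⟨F, hF, htF⟩ := K.exists_isFacet_superset ht
    have := hst.trans htF
    refine ⟨_, ⟨F, ⟨(hl F).1 hF, Finset.subset_union_left.trans this,
      htn ▸ Finset.card_le_card htF⟩, rfl⟩, Finset.subset_sdiff.2 ⟨?_, hdisj.symm⟩⟩
    exact Finset.subset_union_right.trans this
  · rintro ⟨_, ⟨F, ⟨hF, hσF, hn⟩, rfl⟩, hsF⟩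
    obtain ⟨hsF, hdisj⟩ := Finset.subset_sdiff.1 hsF
    obtain ⟨t, hst, htF, htn⟩ := Finset.exists_subsuperset_card_eq (Finset.union_subset hσF hsF)
      ((Finset.card_union_le _ _).trans hs) hn
    exact ⟨hdisj.symm, t, K.down_closed _ ((hl F).2 hF).1 _ htF, htn, hst⟩

/-- A shellable complex is sequentially Cohen–Macaulay over every commutative ring. -/
theorem ShellingList.isSequentiallyCohenMacaulay {K : FinComplex α} {l : List (Finset α)}
    (h : ShellingList l) (hl : ∀ s, K.IsFacet s ↔ s ∈ l) :
    K.IsSequentiallyCohenMacaulay R := by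
  intro d σ hσ m hm
  obtain ⟨t, -, htd, hσt⟩ := mem_pureSkeleton.1 hσ
  -- The degree bound leaves room for faces with up to `m + 1` elements, as the comparison of
  -- boundaries requires.
  have hdim : σ.card + m + 1 ≤ t.card := by
    have hne : ((K.pureSkeleton d).link σ).faces.Nonempty :=
      ⟨∅, mem_link.2 ⟨by simp, by simpa using hσ⟩⟩
    obtain ⟨s, hs, hsup⟩ := Finset.exists_mem_eq_sup _ hne Finset.card
    rw [dim, hsup] at hm
    obtain ⟨hdisj, hs⟩ := mem_link.1 hs
    obtain ⟨t', -, htd', hst'⟩ := mem_pureSkeleton.1 hs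
    have := Finset.card_le_card hst'
    rw [Finset.card_union_of_disjoint hdisj] at this
    omega
  have hmem := fun s => mem_link_pureSkeleton_iff hl htd.symm (σ := σ) (s := s)
  rw [reducedHomology, ← le_bot_iff, Submodule.map_le_iff_le_comap, Submodule.comap_bot,
    Submodule.ker_mkQ, cycles_congr fun s hs => hmem s (by omega),
    boundaries_congr fun s hs => hmem s (by omega)]
  refine (h.map_sdiff_filter σ t.card fun F hF G hG hFG =>
    (((hl F).2 hF).2 G ((hl G).2 hG).1 hFG).symm).cycles_le_boundaries fun F hF => ?_
  obtain ⟨F, hF', rfl⟩ := List.mem_map.1 hF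
  have := List.mem_filter.1 hF'
  simp only [decide_eq_true_eq] at this
  rw [Finset.card_sdiff_of_subset this.2.1]
  omega

/-! ### Cones -/

/-- A cone over a decomposable complex is decomposable. -/
theorem IsDecomposable.cone {k : ℤ} {v : α} {L : FinComplex α} (h : L.IsDecomposable k) :
    ∀ {K : FinComplex α}, (∀ s ∈ L.faces, v ∉ s) →
      (∀ s, s ∈ K.faces ↔ s.erase v ∈ L.faces) → K.IsDecomposable k := by
  induction h with
  | simplex s =>
    intro K _ hK
    rw [show K = FinComplex.simplex (insert v s) from
      ext_mem fun t => by rw [hK, mem_simplex, mem_simplex, Finset.subset_insert_iff]]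
    exact .simplex _
  | void =>
    intro K _ hK
    rw [show K = FinComplex.void from ext_mem fun t => by rw [hK]; simp [FinComplex.void]]
    exact .void
  | shed L σ hσ hdim _ _ ihd ihl =>
    intro K hv hK
    have hvσ := hv σ hσ.1
    refine .shed K σ ⟨?_, fun τ hτ hστ x hx => ?_⟩ hdim (ihd ?_ ?_) (ihl ?_ ?_)
    · rw [hK, Finset.erase_eq_of_notMem hvσ]
      exact hσ.1
    · obtain ⟨w, hw, hwL⟩ := hσ.2 _ ((hK τ).1 hτ) (Finset.subset_erase.2 ⟨hστ, hvσ⟩) x hx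
      have hxv : x ≠ v := fun h => hvσ (h ▸ hx)
      have hwv : w ≠ v := by
        rintro rfl
        exact hv _ hwL (by simp [hxv.symm])
      refine ⟨w, by simpa [hwv] using hw, ?_⟩
      rw [hK, Finset.erase_right_comm, Finset.erase_insert_of_ne hwv]
      exact hwL
    · exact fun s hs => hv s (mem_deletion.1 hs).1
    · intro s
      rw [mem_deletion, mem_deletion, hK, Finset.subset_erase]
      tauto
    · exact fun s hs h => hv _ (mem_link.1 hs).2 (by simp [h])
    · intro s
      rw [mem_link, mem_link, hK, Finset.erase_union_distrib, Finset.erase_eq_of_notMem hvσ,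
        ← Finset.disjoint_erase_comm, Finset.erase_eq_of_notMem hvσ]

end FinComplex

/-! ### Contractions and simplicial vertices -/

namespace Clutter

open FinComplex

variable {α : Type u} [DecidableEq α]

theorem mem_independenceComplex {C : Clutter α} {s : Finset α} :
    s ∈ C.independenceComplex.faces ↔ s ⊆ C.verts ∧ ∀ e ∈ C.circuits, ¬ e ⊆ s := by
  simp [independenceComplex]

theorem exists_minimalSets_subset {S : Finset (Finset α)} {e : Finset α} (he : e ∈ S) :
    ∃ f ∈ minimalSets S, f ⊆ e := by
  obtain ⟨f, hfe, hf⟩ := S.exists_le_minimal he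
  exact ⟨f, Finset.mem_filter.2 ⟨hf.prop, fun e' he' h => hf.eq_of_le he' h⟩, hfe⟩

/-- Contracting a vertex amounts to taking its link in the independence complex. -/
theorem independenceComplex_contract (C : Clutter α) {v : α} (hv : v ∈ C.verts) :
    (C.contract v).independenceComplex = C.independenceComplex.link {v} := by
  refine ext_mem fun s => ?_
  simp only [mem_link, mem_independenceComplex, Finset.disjoint_singleton_left,
    Finset.singleton_union, contract, Finset.subset_erase, Finset.insert_subset_iff, hv, true_and]
  have h : (∀ e ∈ minimalSets (C.circuits.image fun e => e.erase v), ¬ e ⊆ s) ↔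
      ∀ e ∈ C.circuits, ¬ e ⊆ insert v s := by
    simp only [Finset.subset_insert_iff]
    constructor
    · intro h e he hes
      obtain ⟨f, hf, hfe⟩ := exists_minimalSets_subset (Finset.mem_image_of_mem (·.erase v) he)
      exact h f hf (hfe.trans hes)
    · intro h e he
      obtain ⟨e, he', rfl⟩ := Finset.mem_image.1 (Finset.mem_filter.1 he).1
      exact h e he'
  rw [h]
  tauto

/-- Contracting the vertices of `σ` one by one iterates the link. The vertex set is recorded because
its size drives the main induction. -/
theorem exists_isContraction_link (C : Clutter α) (σ : Finset α) : σ ⊆ C.verts →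
    ∃ D, C.IsContraction D ∧ D.verts = C.verts \ σ ∧
      D.independenceComplex = C.independenceComplex.link σ := by
  induction σ using Finset.induction_on with
  | empty => exact fun _ => ⟨C, .refl, by simp, by rw [link_empty]⟩
  | insert a σ ha ih =>
    intro hσ
    obtain ⟨haC, hσ⟩ := Finset.insert_subset_iff.1 hσ
    obtain ⟨D, hD, hDv, hDI⟩ := ih hσ
    have haD : a ∈ D.verts := by simp [hDv, haC, ha]
    refine ⟨D.contract a, .step D a hD haD, ?_, ?_⟩
    · simp only [contract, hDv, Finset.sdiff_insert]
    · rw [independenceComplex_contract D haD, hDI, link_link_singleton _ ha]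

theorem IsContraction.trans {C D E : Clutter α} (h : C.IsContraction D) (h' : D.IsContraction E) :
    C.IsContraction E := by
  induction h' with
  | refl => exact h
  | step E v _ hv ih => exact .step E v ih hv

theorem IsContraction.exists_circuit_superset {C D : Clutter α} (h : C.IsContraction D) :
    ∀ e ∈ D.circuits, ∃ f ∈ C.circuits, e ⊆ f := by
  induction h with
  | refl => exact fun e he => ⟨e, he, subset_rfl⟩
  | step D v _ _ ih =>
    intro e he
    obtain ⟨e, he', rfl⟩ := Finset.mem_image.1 (Finset.mem_filter.1 he).1
    obtain ⟨f, hf, hef⟩ := ih e he'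
    exact ⟨f, hf, (Finset.erase_subset _ _).trans hef⟩

/-- If `v` is simplicial, the sets `e \ {v}`, for `e` a circuit containing `v`, can be shed in any
order. What remains after that is a cone over the link of `v`. -/
theorem IsSimplicialVertex.isDecomposable {C : Clutter α} {v : α} {k : ℤ}
    (hv : C.IsSimplicialVertex v) (hcard : ∀ e ∈ C.circuits, (e.card : ℤ) - 2 ≤ k)
    (hvl : (C.independenceComplex.link {v}).IsDecomposable k)
    (hlink : ∀ e ∈ C.circuits, v ∈ e →
      (C.independenceComplex.link (e.erase v)).IsDecomposable k) :
    C.independenceComplex.IsDecomposable k := by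
  -- `T` holds the circuits through `v` already treated, `S` those still to be shed.
  have key : ∀ (S : Finset (Finset α)) (T : Finset (Finset α)),
      C.circuits.filter (v ∈ ·) = S ∪ T → Disjoint S T → ∀ K : FinComplex α,
      (∀ s, s ∈ K.faces ↔ s ∈ C.independenceComplex.faces ∧ ∀ e ∈ T, ¬ e.erase v ⊆ s) →
      K.IsDecomposable k := by
    intro S
    induction S using Finset.induction_on with
    | empty =>
      intro T hT _ K hK
      rw [Finset.empty_union] at hT
      subst hT
      -- A circuit in `s ∪ {v}` either avoids `v` and lies in `s`, or contains `v` and has its trace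
      -- `e \ {v}` in `s`. With all traces deleted, `v` is a cone point.
      refine hvl.cone (v := v) (fun s hs => ?_) fun s => ?_
      · simpa using (mem_link.1 hs).1
      · rw [hK, mem_link]
        simp only [mem_independenceComplex, Finset.disjoint_singleton_left, Finset.notMem_erase,
          not_false_eq_true, true_and, Finset.singleton_union, Finset.insert_subset_iff, hv.1,
          Finset.mem_filter, ← Finset.subset_insert_iff, and_imp,
          show insert v (s.erase v) = insert v s by grind]
        constructor
        · rintro ⟨⟨h₁, h₂⟩, h₃⟩
          refine ⟨h₁, fun e he hes => ?_⟩
          by_cases hve : v ∈ e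
          · exact h₃ e he hve hes
          · exact h₂ e he ((Finset.subset_insert_iff_of_notMem hve).1 hes)
        · rintro ⟨h₁, h₂⟩
          exact ⟨⟨h₁, fun e he hes => h₂ e he (hes.trans (Finset.subset_insert _ _))⟩,
            fun e he _ => h₂ e he⟩
    | insert e S heS ih =>
      intro T hT hd K hK
      rw [Finset.disjoint_insert_left] at hd
      have hmem : ∀ f, f ∈ insert e S ∪ T ↔ f ∈ C.circuits ∧ v ∈ f := by
        simp [← hT]
      obtain ⟨he, hve⟩ := (hmem e).1 (by simp)
      have hTC : ∀ f ∈ T, f ∈ C.circuits ∧ v ∈ f ∧ e ≠ f := fun f hf =>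
        ⟨((hmem f).1 (by simp [hf])).1, ((hmem f).1 (by simp [hf])).2,
          fun h => hd.1 (h ▸ hf)⟩
      have hsimp : ∀ τ ∈ C.independenceComplex.faces, e.erase v ⊆ τ → ∀ f ∈ C.circuits, v ∈ f →
          e ≠ f → ¬ f.erase v ⊆ τ := by
        intro τ hτ heτ f hf hvf hef hfτ
        obtain ⟨g, hg, hgsub⟩ := hv.2 e he f hf hef hve hvf
        rw [Finset.erase_union_distrib] at hgsub
        exact (mem_independenceComplex.1 hτ).2 g hg
          (hgsub.trans (Finset.union_subset heτ hfτ))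
      -- Earlier deletions removed no face above `e \ {v}`, so its link in `K` is the original one.
      have hKe : ∀ τ, e.erase v ⊆ τ → (τ ∈ K.faces ↔ τ ∈ C.independenceComplex.faces) :=
        fun τ heτ => by
          rw [hK, and_iff_left_iff_imp]
          exact fun h f hf => hsimp τ h heτ f (hTC f hf).1 (hTC f hf).2.1 (hTC f hf).2.2
      have heI : e.erase v ∈ C.independenceComplex.faces := by
        refine mem_independenceComplex.2
          ⟨(Finset.erase_subset _ _).trans (C.circuit_subset e he), fun f hf hfe => ?_⟩
        have := C.antichain f hf e he (hfe.trans (Finset.erase_subset _ _))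
        rw [this] at hfe
        simpa using hfe hve
      refine .shed K (e.erase v) ⟨(hKe _ subset_rfl).2 heI, fun τ hτ heτ x hx => ?_⟩ ?_
        (ih (insert e T) ?_ ?_ _ fun s => ?_) ?_
      · have hτI := ((hK τ).1 hτ).1
        obtain ⟨hτV, hτC⟩ := mem_independenceComplex.1 hτI
        obtain ⟨hxv, hxe⟩ := Finset.mem_erase.1 hx
        -- The exchange vertex is `v`. The only circuit that `τ ∪ {v}` contains is `e`, and removing
        -- `x` destroys it.
        refine ⟨v, fun h => hτC e he (by
          rw [← Finset.insert_erase hve]; exact Finset.insert_subset h heτ), (hK _).2 ⟨?_, ?_⟩⟩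
        · refine mem_independenceComplex.2 ⟨(Finset.erase_subset _ _).trans
            (Finset.insert_subset hv.1 hτV), fun f hf hfs => ?_⟩
          have hfτ := Finset.subset_insert_iff.1 (hfs.trans (Finset.erase_subset _ _))
          by_cases hvf : v ∈ f
          · refine hsimp τ hτI heτ f hf hvf ?_ hfτ
            rintro rfl
            simpa using hfs hxe
          · exact hτC f hf (by rwa [Finset.erase_eq_of_notMem hvf] at hfτ)
        · intro f hf hfs
          refine ((hK τ).1 hτ).2 f hf ?_
          have := Finset.subset_insert_iff.1 (hfs.trans (Finset.erase_subset _ _))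
          rwa [Finset.erase_idem] at this
      · have := hcard e he
        rw [faceDim, Finset.card_erase_of_mem hve, Nat.cast_sub (Finset.card_pos.2 ⟨v, hve⟩)]
        push_cast
        omega
      · rw [hT]
        ext f
        simp only [Finset.mem_union, Finset.mem_insert]
        tauto
      · rw [Finset.disjoint_insert_right]
        exact ⟨heS, hd.2⟩
      · rw [mem_deletion, hK]
        simp only [Finset.forall_mem_insert]
        tauto
      · rw [show K.link (e.erase v) = C.independenceComplex.link (e.erase v) from
          ext_mem fun s => by rw [mem_link, mem_link, hKe _ Finset.subset_union_left]]
        exact hlink e he hve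
  exact key _ ∅ (Finset.union_empty _).symm (Finset.disjoint_empty_right _) _ (by simp)

/-- The integer `k` is only an upper bound, so that it can stay fixed when contraction shrinks the
circuits. -/
theorem isDecomposable_independenceComplex {k : ℤ} (n : ℕ) :
    ∀ C : Clutter α, C.verts.card = n → (∀ e ∈ C.circuits, (e.card : ℤ) - 2 ≤ k) →
    (∀ D : Clutter α, C.IsContraction D → (∃ x, D.IsIndependent {x}) →
      ∃ v, D.IsIndependent {v} ∧ D.IsSimplicialVertex v) →
    C.independenceComplex.IsDecomposable k := by
  induction n using Nat.strong_induction_on with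
  | _ n ih =>
    intro C hn hk hC
    have hlink : ∀ σ ∈ C.independenceComplex.faces, σ.Nonempty →
        (C.independenceComplex.link σ).IsDecomposable k := by
      intro σ hσ hne
      have hσC := (mem_independenceComplex.1 hσ).1
      obtain ⟨D, hD, hDv, hDI⟩ := C.exists_isContraction_link σ hσC
      rw [← hDI]
      refine ih D.verts.card ?_ D rfl (fun e he => ?_) fun E hE => hC E (hD.trans hE)
      · rw [hDv, ← hn]
        exact Finset.card_lt_card (Finset.sdiff_ssubset hσC hne)
      · obtain ⟨f, hf, hef⟩ := hD.exists_circuit_superset e he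
        have := hk f hf
        have := Finset.card_le_card hef
        omega
    by_cases hx : ∃ x, C.IsIndependent {x}
    · obtain ⟨v, hvI, hv⟩ := hC C .refl hx
      refine hv.isDecomposable hk (hlink _ (mem_independenceComplex.2 hvI) (by simp))
        fun e he hve => hlink _ (mem_independenceComplex.2
          ⟨(Finset.erase_subset _ _).trans (C.circuit_subset e he), fun f hf hfe => ?_⟩) ?_
      · have := C.antichain f hf e he (hfe.trans (Finset.erase_subset _ _))
        rw [this] at hfe
        simpa using hfe hve
      -- Independence of `{v}` rules out `e = {v}`; thus the link of `e \ {v}` has fewer vertices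
      -- and the induction applies.
      · rw [Finset.nonempty_iff_ne_empty, Ne, Finset.erase_eq_empty_iff]
        rintro (rfl | rfl)
        · simp at hve
        · exact hvI.2 _ he subset_rfl
    -- With no independent vertex the complex is `{∅}`, or void when `∅` is a circuit.
    · have hface : ∀ s ∈ C.independenceComplex.faces, s = ∅ := by
        intro s hs
        rw [Finset.eq_empty_iff_forall_notMem]
        exact fun x hxs => hx ⟨x, mem_independenceComplex.1
          (C.independenceComplex.down_closed s hs _ (by simpa using hxs))⟩
      by_cases h : ∅ ∈ C.independenceComplex.faces
      · rw [show C.independenceComplex = simplex ∅ from ext_mem fun s => by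
          rw [mem_simplex, Finset.subset_empty]
          exact ⟨hface s, fun hs => hs ▸ h⟩]
        exact .simplex _
      · rw [show C.independenceComplex = void from ext_mem fun s => by
          simp only [void, Finset.notMem_empty, iff_false]
          exact fun hs => h (hface s hs ▸ hs)]
        exact .void

end Clutter

/-- Condition `hC` concerns the contractions `D` of `C` up to singleton circuits: vertices `x` such
that `{x}` is not independent in `D` are disregarded, and if other vertices are left then one of
them has to be simplicial. -/
theorem mainTheorem4 {α : Type u} [DecidableEq α] (C : Clutter α) (k : ℕ)
    (hk : C.maxCircuitCard = k)
    (hC : ∀ D : Clutter α, C.IsContraction D → (∃ x, D.IsIndependent {x}) →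
      ∃ v, D.IsIndependent {v} ∧ D.IsSimplicialVertex v) :
    C.independenceComplex.IsDecomposable ((k : ℤ) - 2) ∧
    C.independenceComplex.IsShellable ∧
    (∀ (F : Type w) [Field F], C.independenceComplex.IsSequentiallyCohenMacaulay F) ∧
    C.independenceComplex.IsSequentiallyCohenMacaulay ℤ := by
  have h : C.independenceComplex.IsDecomposable ((k : ℤ) - 2) := by
    refine Clutter.isDecomposable_independenceComplex _ C rfl (fun e he => ?_) hC
    have : e.card ≤ C.maxCircuitCard := Finset.le_sup (f := Finset.card) he
    omega
  obtain ⟨l, hl, hfacet⟩ := h.exists_shellingList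
  exact ⟨h, hl.isShellable hfacet, fun _ _ => hl.isSequentiallyCohenMacaulay hfacet,
    hl.isSequentiallyCohenMacaulay hfacet⟩
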